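/- A constellation is a finite collection $\mathcal{C}$ of circles (of positive radius) in the Euclidean plane such that no three circles of $\mathcal{C}$ are tangent at the same point. Its tangency graph $G(\mathcal{C})$ has vertex set $\mathcal{C}$, and two distinct circles are adjacent if and only if they are tangent (internally or externally). The girth of a graph is the minimum length of a cycle ($\infty$ if there is no cycle). For all natural numbers $g$ and $k$ there exists a constellation $\mathcal{C}$ of circles in the plane such that $G(\mathcal{C})$ has girth at least $g$ and chromatic number at least $k$. -/

import Mathlib

open EuclideanGeometry

/-- The Euclidean plane. -/
abbrev Plane : Type := EuclideanSpace ℝ (Fin 2)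

/-- Two distinct circles are tangent at `p` if they touch at `p`, externally or internally
(either one may be the inner circle). -/
def TangentAt (s t : Sphere Plane) (p : Plane) : Prop :=
  s ≠ t ∧ (s.IsExtTangentAt t p ∨ s.IsIntTangentAt t p ∨ t.IsIntTangentAt s p)

theorem TangentAt.symm {s t : Sphere Plane} {p : Plane} (h : TangentAt s t p) :
    TangentAt t s p :=
  ⟨h.1.symm, h.2.elim (fun e => Or.inl e.symm) (fun i => Or.inr i.symm)⟩

/-- A constellation: a finite collection of circles (of positive radius) in the plane, no three
of which are tangent at the same point. -/
structure IsConstellation (C : Finset (Sphere Plane)) : Prop where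
  radius_pos : ∀ s ∈ C, 0 < s.radius
  no_three_tangent : ∀ s ∈ C, ∀ t ∈ C, ∀ u ∈ C, ∀ p : Plane,
    ¬ (TangentAt s t p ∧ TangentAt t u p ∧ TangentAt s u p)

/-- The tangency graph of a collection of circles: the vertices are the circles of the collection,
and two circles are adjacent if and only if they are tangent at some point. -/
def tangencyGraph (C : Finset (Sphere Plane)) : SimpleGraph {s : Sphere Plane // s ∈ C} where
  Adj s t := ∃ p : Plane, TangentAt s.1 t.1 p
  symm := ⟨fun _ _ ⟨p, hp⟩ => ⟨p, hp.symm⟩⟩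
  loopless := ⟨fun _ ⟨_, hp⟩ => hp.1 rfl⟩

/-!
A circle with center `z` and radius `r` is regarded as the point `(z, r)` of Minkowski space
`ℂ × ℝ`. Internal tangency of two different circles means that their points are null separated,
`|z - z'| = |r - r'|`. Adding a large constant to all radii keeps this relation, makes the radii
positive and excludes external tangency. So it suffices to find finite sets of points whose graph of
null separation has no short cycle and large chromatic number. Three circles tangent at one point
would form a triangle, so the condition on triple tangencies comes for free.

The chromatic number is raised by Tutte's construction (`HasNullFamily.succ`). Points on the axis
`{0} × ℝ`, i.e. concentric circles, are never null separated. In general position the null cones of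
the points `v` of a given family meet the axis at distinct heights `t v`. If a set of points on the
axis is such that each `k + 1`-colouring of it has a monochromatic homothetic copy of `{t v}`, add
for each such copy the corresponding homothetic copy of the family: in a proper `k + 1`-colouring,
one of these copies avoids a colour. The rotations about the axis fix the axis pointwise; rotating
the copies of the family generically prevents null separation of points in different copies.

To keep the girth large, the homothetic copies of `{t v}` have to form a hypergraph without short
cycles. They come from a sparse Hales–Jewett theorem (`hasSparseLines`) by a generic linear map of
the cube to the axis. It is proved by the partite construction: starting from disjoint lifts of all
lines of a Hales–Jewett cube, the fibre over each point of that cube in turn is replaced by a cube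
over the fibre as alphabet, with copies of the whole picture along a family of lines that is sparse
in a weaker sense.

Both constructions amalgamate copies of one hypergraph along a common part, and absence of short
cycles is treated uniformly, as the inequality `∑ |f e| < |⋃ f e| + |M|` for all small subfamilies
`M`, in `SparseFamily.amalgam`.
-/

open Combinatorics

/-! ### Sparse families of sets -/

open scoped Classical in
/-- A family of finite sets is `p`-sparse if every nonempty subfamily of at most `p` members
is a hyperforest, in the sense that its incidence graph has fewer edges (`∑ |f e|`) than vertices
(`|⋃ f e| + |M|`). For a graph, regarded as the family of its edges, this says that there is no
cycle of length at most `p`. -/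
def SparseFamily {V E : Type*} (p : ℕ) (f : E → Finset V) : Prop :=
  ∀ M : Finset E, M.Nonempty → M.card ≤ p → ∑ e ∈ M, (f e).card < (M.biUnion f).card + M.card

namespace SparseFamily

variable {V W E I : Type*} {p q : ℕ}

theorem sum_card_lt [DecidableEq V] {f : E → Finset V} (hf : SparseFamily p f) {M : Finset E}
    (hM : M.Nonempty) (hp : M.card ≤ p) :
    ∑ e ∈ M, (f e).card < (M.biUnion f).card + M.card := by
  convert hf M hM hp

theorem of_sum_card_lt [DecidableEq V] {f : E → Finset V}
    (hf : ∀ M : Finset E, M.Nonempty → M.card ≤ p →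
      ∑ e ∈ M, (f e).card < (M.biUnion f).card + M.card) : SparseFamily p f := by
  intro M hM hp
  convert hf M hM hp

theorem comp_injective {f : E → Finset V} (hf : SparseFamily p f) {s : I → E}
    (hs : Function.Injective s) : SparseFamily p (f ∘ s) := by
  classical
  refine of_sum_card_lt fun M hM hp => ?_
  have := hf.sum_card_lt (M := M.map ⟨s, hs⟩) (by simpa using hM) (by simpa using hp)
  rw [Finset.sum_map, Finset.card_map, Finset.map_eq_image, Finset.image_biUnion] at this
  simpa [Function.comp_def] using this

theorem map {f : E → Finset V} (hf : SparseFamily p f) (s : V ↪ W) :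
    SparseFamily p (fun e => (f e).map s) := by
  classical
  refine of_sum_card_lt fun M hM hp => ?_
  have := hf.sum_card_lt hM hp
  simp only [Finset.map_eq_image] at this ⊢
  rw [← Finset.biUnion_image, Finset.card_image_of_injective _ s.injective]
  simpa [Finset.card_image_of_injective _ s.injective] using this

/-- Sparsity passes to families of subsets: a point removed from the union had at least one
incidence. -/
theorem subset {f g : E → Finset V} (hf : SparseFamily p f) (h : ∀ e, g e ⊆ f e) :
    SparseFamily p g := by
  classical
  refine of_sum_card_lt fun M hM hp => ?_
  have h1 := hf.sum_card_lt hM hp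
  have h2 : ∑ e ∈ M, (f e).card = ∑ e ∈ M, (g e).card + ∑ e ∈ M, (f e \ g e).card := by
    rw [← Finset.sum_add_distrib]
    refine Finset.sum_congr rfl fun e _ => ?_
    rw [add_comm, Finset.card_sdiff_add_card_eq_card (h e)]
  have h3 : (M.biUnion f).card ≤ (M.biUnion g).card + ∑ e ∈ M, (f e \ g e).card := by
    calc (M.biUnion f).card ≤ (M.biUnion g ∪ M.biUnion fun e => f e \ g e).card := by
          apply Finset.card_le_card
          intro x hx
          simp only [Finset.mem_biUnion, Finset.mem_union, Finset.mem_sdiff] at hx ⊢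
          obtain ⟨e, he, hx⟩ := hx
          by_cases hg : x ∈ g e
          · exact Or.inl ⟨e, he, hg⟩
          · exact Or.inr ⟨e, he, hx, hg⟩
      _ ≤ _ := (Finset.card_union_le _ _).trans (Nat.add_le_add_left Finset.card_biUnion_le _)
  omega

/-- Members with at most one point do not count against the size bound in sparsity. -/
theorem sum_card_lt_of_card_filter_le [DecidableEq V] {f : E → Finset V}
    (hf : SparseFamily p f) {M : Finset E} (hM : M.Nonempty) (hp : (M.filter fun e => 2 ≤ (f e).card).card ≤ p) :
    ∑ e ∈ M, (f e).card < (M.biUnion f).card + M.card := by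
  classical
  have hsplit := Finset.sum_filter_add_sum_filter_not M (fun e => 2 ≤ (f e).card)
    (fun e => (f e).card)
  have hcard := Finset.card_filter_add_card_filter_not (s := M) (fun e => 2 ≤ (f e).card)
  have hsmall : ∑ e ∈ M with ¬ 2 ≤ (f e).card, (f e).card
      ≤ (M.filter fun e => ¬ 2 ≤ (f e).card).card := by
    rw [Finset.card_eq_sum_ones]
    refine Finset.sum_le_sum fun e he => ?_
    have := (Finset.mem_filter.1 he).2
    omega
  rcases (M.filter fun e => 2 ≤ (f e).card).eq_empty_or_nonempty with h0 | h0
  · rw [h0] at hsplit hcard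
    simp only [Finset.sum_empty, Finset.card_empty, zero_add] at hsplit hcard
    rcases (M.biUnion f).eq_empty_or_nonempty with hU | hU
    · have : ∑ e ∈ M, (f e).card = 0 := by
        refine Finset.sum_eq_zero fun e he => ?_
        rw [Finset.card_eq_zero, ← Finset.subset_empty, ← hU]
        exact Finset.subset_biUnion_of_mem f he
      have := hM.card_pos
      omega
    · have := hU.card_pos
      omega
  · have h1 := hf.sum_card_lt h0 hp
    have h2 : ((M.filter fun e => 2 ≤ (f e).card).biUnion f).card ≤ (M.biUnion f).card :=
      Finset.card_le_card (Finset.biUnion_subset_biUnion_of_subset_left _ (Finset.filter_subset _ _))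
    omega

/-- Amalgamation of copies `c i` of one `q`-sparse family along a common part `P`. The traces of the
copies on the part lie in the members of a `p`-sparse family `B`, different copies meet only in the
part, and each set of the family meets the part at most once. A copy that matters for connectivity
has two points in the part, hence uses at least two sets; so `q ≤ 2 * p` suffices for the union of
all copies to be `q`-sparse. -/
theorem amalgam {f : E → Finset V} (hf : SparseFamily q f) {B : I → Finset W}
    (hB : SparseFamily p B) (hqp : q ≤ 2 * p) (P : V → Prop) (c : I → V ↪ W)
    (hdisj : ∀ i j v w, c i v = c j w → i ≠ j → P v)
    (hPB : ∀ i v, P v → c i v ∈ B i)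
    (hfP : ∀ e, ∀ v ∈ f e, ∀ w ∈ f e, P v → P w → v = w) :
    SparseFamily q (fun x : I × E => (f x.2).map (c x.1)) := by
  classical
  refine of_sum_card_lt fun M hM hq => ?_
  set K := M.image Prod.fst with hK
  have hKne : K.Nonempty := hM.image _
  -- the sets used in the copy with index `i`
  let S : I → Finset E := fun i => (M.filter fun x => x.1 = i).image Prod.snd
  have hS : ∀ i e, e ∈ S i ↔ (i, e) ∈ M := by
    intro i e
    simp only [S, Finset.mem_image, Finset.mem_filter]
    constructor
    · rintro ⟨⟨a, b⟩, ⟨h, rfl⟩, rfl⟩; exact h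
    · intro h; exact ⟨(i, e), ⟨h, rfl⟩, rfl⟩
  have hScard : ∀ i, (S i).card = (M.filter fun x => x.1 = i).card := by
    intro i
    refine Finset.card_image_of_injOn ?_
    rintro ⟨a, b⟩ h ⟨a', b'⟩ h' hb
    simp only [Finset.coe_filter, Set.mem_ofPred_eq] at h h'
    exact Prod.ext (h.2.trans h'.2.symm) hb
  have hMeq : M = (K.sigma S : Finset (Σ _ : I, E)).image (fun x => (x.1, x.2)) := by
    ext ⟨i, e⟩
    simp only [Finset.mem_image, Finset.mem_sigma, hK, hS]
    constructor
    · intro h; exact ⟨⟨i, e⟩, ⟨⟨_, h, rfl⟩, h⟩, rfl⟩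
    · rintro ⟨⟨i', e'⟩, ⟨-, h⟩, h'⟩
      cases h'; exact h
  have hsum : ∀ φ : I × E → ℕ, ∑ x ∈ M, φ x = ∑ i ∈ K, ∑ e ∈ S i, φ (i, e) := by
    intro φ
    rw [hMeq, Finset.sum_image, Finset.sum_sigma]
    rintro ⟨a, b⟩ - ⟨a', b'⟩ - h
    cases h; rfl
  have hMcard : M.card = ∑ i ∈ K, (S i).card := by
    simpa using hsum fun _ => 1
  have hSne : ∀ i ∈ K, (S i).Nonempty := by
    intro i hi
    obtain ⟨⟨a, b⟩, h, rfl⟩ := Finset.mem_image.1 hi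
    exact ⟨b, (hS _ _).2 h⟩
  have hSle : ∀ i ∈ K, (S i).card ≤ q := fun i hi =>
    ((hScard i).trans_le (Finset.card_filter_le _ _)).trans hq
  let U : I → Finset V := fun i => (S i).biUnion f
  let Y : I → Finset W := fun i => ((U i).filter P).map (c i)
  let Z : I → Finset W := fun i => ((U i).filter fun v => ¬ P v).map (c i)
  have hUcard : ∀ i, (U i).card = (Y i).card + (Z i).card := by
    intro i
    simp only [Y, Z]
    rw [Finset.card_map, Finset.card_map, Finset.card_filter_add_card_filter_not]
  have hYS : ∀ i, (Y i).card ≤ (S i).card := by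
    intro i
    simp only [Y]
    rw [Finset.card_map]
    simp only [U]
    rw [Finset.filter_biUnion]
    refine Finset.card_biUnion_le.trans ?_
    rw [Finset.card_eq_sum_ones]
    refine Finset.sum_le_sum fun e _ => ?_
    rw [Finset.card_le_one]
    intro a ha b hb
    rw [Finset.mem_filter] at ha hb
    exact hfP e a ha.1 b hb.1 ha.2 hb.2
  have hY : SparseFamily p Y := hB.subset fun i => by
    intro x hx
    obtain ⟨v, hv, rfl⟩ := Finset.mem_map.1 hx
    exact hPB i v (Finset.mem_filter.1 hv).2
  have hYK := hY.sum_card_lt_of_card_filter_le hKne (by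
    have h1 : (K.filter fun i => 2 ≤ (Y i).card).card * 2 ≤
        ∑ i ∈ K with 2 ≤ (Y i).card, (S i).card := by
      rw [← smul_eq_mul]
      refine Finset.card_nsmul_le_sum _ _ _ fun i hi => ?_
      exact (Finset.mem_filter.1 hi).2.trans (hYS i)
    have h2 : ∑ i ∈ K with 2 ≤ (Y i).card, (S i).card ≤ ∑ i ∈ K, (S i).card :=
      Finset.sum_le_sum_of_subset (Finset.filter_subset _ _)
    omega)
  have hunion : (K.biUnion Y).card + ∑ i ∈ K, (Z i).card
      ≤ (M.biUnion fun x : I × E => (f x.2).map (c x.1)).card := by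
    rw [← Finset.card_biUnion, ← Finset.card_union_of_disjoint]
    · refine Finset.card_le_card (Finset.union_subset ?_ ?_)
      all_goals
        intro x hx
        simp only [Y, Z, U, Finset.mem_biUnion, Finset.mem_map, Finset.mem_filter, hS] at hx ⊢
        obtain ⟨i, -, v, ⟨⟨e, he, hv⟩, -⟩, rfl⟩ := hx
        exact ⟨(i, e), he, v, hv, rfl⟩
    · rw [Finset.disjoint_left]
      intro x hx hx'
      simp only [Y, Z, Finset.mem_biUnion, Finset.mem_map, Finset.mem_filter] at hx hx'
      obtain ⟨i, -, v, ⟨-, hv⟩, rfl⟩ := hx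
      obtain ⟨j, -, w, ⟨-, hw⟩, h⟩ := hx'
      by_cases hij : j = i
      · subst hij
        exact hw ((c _).injective h ▸ hv)
      · exact hw (hdisj _ _ _ _ h hij)
    · intro i _ j _ hij
      rw [Function.onFun, Finset.disjoint_left]
      intro x hx hx'
      simp only [Z, Finset.mem_map, Finset.mem_filter] at hx hx'
      obtain ⟨v, ⟨-, hv⟩, rfl⟩ := hx
      obtain ⟨w, -, h⟩ := hx'
      exact hv (hdisj _ _ _ _ h.symm hij)
  have hcopies : ∑ x ∈ M, ((f x.2).map (c x.1)).card + K.card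
      ≤ ∑ i ∈ K, (U i).card + ∑ i ∈ K, (S i).card := by
    rw [hsum, Finset.card_eq_sum_ones, ← Finset.sum_add_distrib, ← Finset.sum_add_distrib]
    refine Finset.sum_le_sum fun i hi => ?_
    have := hf.sum_card_lt (hSne i hi) (hSle i hi)
    simp only [Finset.card_map]
    exact this
  simp only [hUcard, Finset.sum_add_distrib] at hcopies
  change ∑ x ∈ M, ((f x.2).map (c x.1)).card < _
  omega

/-- Attaching to each vertex `inr v` of a sparse family a new pendant edge `{inl v, inr v}`
preserves sparsity. -/
theorem pendant [DecidableEq V] {f : E → Finset V} (hf : SparseFamily p f) :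
    SparseFamily p (Sum.elim (fun e => (f e).map Function.Embedding.inr)
      (fun v => {Sum.inl v, Sum.inr v}) : E ⊕ V → Finset (V ⊕ V)) := by
  refine of_sum_card_lt fun M hM hp => ?_
  have hMe : M = M.toLeft.disjSum M.toRight := (Finset.toLeft_disjSum_toRight).symm
  have hcard : M.card = M.toLeft.card + M.toRight.card := by
    rw [Finset.card_toLeft_add_card_toRight]
  rw [hcard] at hp ⊢
  rw [hMe, Finset.sum_disjSum]
  simp only [Sum.elim_inl, Sum.elim_inr, Finset.card_map]
  have h2 : ∑ v ∈ M.toRight, ({Sum.inl v, Sum.inr v} : Finset (V ⊕ V)).card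
      = 2 * M.toRight.card := by
    rw [Finset.sum_congr rfl fun v _ => Finset.card_pair Sum.inl_ne_inr, Finset.sum_const,
      smul_eq_mul, mul_comm]
  rw [h2, ← hMe]
  have hle : M.toRight.card + (M.toRight ∪ M.toLeft.biUnion f).card ≤ (M.biUnion (Sum.elim
      (fun e => (f e).map Function.Embedding.inr) (fun v => {Sum.inl v, Sum.inr v}) :
        E ⊕ V → Finset (V ⊕ V))).card := by
    rw [← Finset.card_disjSum]
    refine Finset.card_le_card ?_
    intro x hx
    rw [Finset.mem_biUnion]
    rcases Finset.mem_disjSum.1 hx with ⟨v, hv, rfl⟩ | ⟨v, hv, rfl⟩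
    · exact ⟨Sum.inr v, Finset.mem_toRight.1 hv, by simp⟩
    · rcases Finset.mem_union.1 hv with hv | hv
      · exact ⟨Sum.inr v, Finset.mem_toRight.1 hv, by simp⟩
      obtain ⟨e, he, hv⟩ := Finset.mem_biUnion.1 hv
      exact ⟨Sum.inl e, Finset.mem_toLeft.1 he, by simpa using hv⟩
  rcases M.toLeft.eq_empty_or_nonempty with h0 | h0
  · have hpos := hM.card_pos
    have := Finset.card_le_card (Finset.subset_union_left (s₁ := M.toRight)
      (s₂ := M.toLeft.biUnion f))
    simp only [h0, Finset.sum_empty, Finset.card_empty] at hcard ⊢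
    omega
  · have := Finset.card_le_card (Finset.subset_union_right (s₁ := M.toRight)
      (s₂ := M.toLeft.biUnion f))
    have := hf.sum_card_lt h0 (by omega)
    omega

end SparseFamily

/-! ### The sparse Hales–Jewett theorem -/

theorem line_injective {A ι : Type*} (l : Line A ι) : Function.Injective l := by
  intro a b h
  obtain ⟨i, hi⟩ := l.proper
  simpa [hi] using congrFun h i

/-- The finite set of points of a combinatorial line. -/
def linePoints {A ι : Type*} [Fintype A] (l : Line A ι) : Finset (ι → A) :=
  Finset.univ.map ⟨l, line_injective l⟩

theorem mem_linePoints {A ι : Type*} [Fintype A] {l : Line A ι} {x : ι → A} :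
    x ∈ linePoints l ↔ ∃ a, l a = x := by
  simp [linePoints]

instance finite_line {A ι : Type*} [Finite A] [Finite ι] : Finite (Line A ι) :=
  Finite.of_injective (fun l : Line A ι => l.idxFun) fun _ _ h => Line.ext h

/-- The copy of the cube `A ^ (m ⊕ ι)` in `A ^ (m ⊕ N × (m ⊕ ι))` given by a line `L` over the
alphabet `A ^ ι`. This alphabet stands for the fibre over `x` of the restriction
`A ^ (m ⊕ ι) → A ^ m`. The active coordinates of `L` carry the point `v` itself, the fixed ones
carry fixed points of the fibre, and the restriction to `m` is kept. -/
def cubeCopy {A m ι N : Type*} (x : m → A) (L : Line (ι → A) N) (v : m ⊕ ι → A) :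
    m ⊕ N × (m ⊕ ι) → A :=
  Sum.elim (v ∘ Sum.inl) fun z => (L.idxFun z.1).elim (v z.2) fun b => Sum.elim x b z.2

/-- The image of a line under `cubeCopy`. -/
def lineCopy {A m ι N : Type*} (x : m → A) (L : Line (ι → A) N) (l : Line A (m ⊕ ι))
    (h : ∃ i, l.idxFun (Sum.inl i) = none) : Line A (m ⊕ N × (m ⊕ ι)) where
  idxFun := Sum.elim (l.idxFun ∘ Sum.inl) fun z =>
    (L.idxFun z.1).elim (l.idxFun z.2) fun b => some (Sum.elim x b z.2)
  proper := h.imp' Sum.inl fun _ hi => hi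

theorem lineCopy_apply {A m ι N : Type*} (x : m → A) (L : Line (ι → A) N) (l : Line A (m ⊕ ι))
    (h : ∃ i, l.idxFun (Sum.inl i) = none) (a : A) :
    lineCopy x L l h a = cubeCopy x L (l a) := by
  funext z
  rcases z with i | ⟨n, z⟩
  · simp [lineCopy, cubeCopy]
  · cases hL : L.idxFun n <;> simp [lineCopy, cubeCopy, hL]

theorem cubeCopy_injective {A m ι N : Type*} (x : m → A) (L : Line (ι → A) N) :
    Function.Injective (cubeCopy x L) := by
  intro v w h
  obtain ⟨n, hn⟩ := L.proper
  funext z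
  simpa [cubeCopy, hn] using congrFun h (Sum.inr (n, z))

/-- Two different copies of the cube meet only in the fibre over `x`. -/
theorem comp_inl_eq_of_cubeCopy_eq {A m ι N : Type*} {x : m → A} {L L' : Line (ι → A) N}
    {v w : m ⊕ ι → A} (h : cubeCopy x L v = cubeCopy x L' w) (hL : L ≠ L') :
    v ∘ Sum.inl = x := by
  have hvw : v ∘ Sum.inl = w ∘ Sum.inl := by
    funext i
    simpa [cubeCopy] using congrFun h (Sum.inl i)
  by_contra hx
  refine hL (Line.ext (funext fun n => ?_))
  have hn : ∀ z, (L.idxFun n).elim (v z) (fun b => Sum.elim x b z)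
      = (L'.idxFun n).elim (w z) fun b => Sum.elim x b z := fun z => by
    simpa [cubeCopy] using congrFun h (Sum.inr (n, z))
  cases h1 : L.idxFun n with
  | none =>
    cases h2 : L'.idxFun n with
    | none => rfl
    | some b =>
      refine absurd (funext fun i => ?_) hx
      simpa [h1, h2] using hn (Sum.inl i)
  | some b =>
    cases h2 : L'.idxFun n with
    | none =>
      refine absurd (hvw.trans (funext fun i => ?_)) hx
      simpa [h1, h2] using (hn (Sum.inl i)).symm
    | some b' =>
      congr 1
      funext i
      simpa [h1, h2] using hn (Sum.inr i)

/-- The points over `x` of the big cube that the copies of the fibre over `x` consist of. -/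
def fibrePoint {A m ι N : Type*} (x : m → A) (y : N → ι → A) : m ⊕ N × (m ⊕ ι) → A :=
  Sum.elim x fun z => Sum.elim x (y z.1) z.2

theorem fibrePoint_injective {A m ι N : Type*} (x : m → A) :
    Function.Injective (fibrePoint x : (N → ι → A) → _) := by
  intro y y' h
  funext n i
  simpa [fibrePoint] using congrFun h (Sum.inr (n, Sum.inr i))

theorem cubeCopy_sumElim {A m ι N : Type*} (x : m → A) (L : Line (ι → A) N) (b : ι → A) :
    cubeCopy x L (Sum.elim x b) = fibrePoint x (L b) := by
  funext z
  rcases z with i | ⟨n, z⟩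
  · simp [cubeCopy, fibrePoint]
  · cases hL : L.idxFun n <;> simp [cubeCopy, fibrePoint, hL]

/-- There is a `p`-sparse family of combinatorial lines over the alphabet `A`, in some cube, such
that each colouring of the cube with colours in `κ` is constant on a line of the family. -/
def HasSparseLines (p : ℕ) (κ A : Type) [Fintype A] : Prop :=
  ∃ (ι E : Type) (_ : Fintype ι) (_ : Fintype E) (l : E → Line A ι),
    SparseFamily p (fun e => linePoints (l e)) ∧ ∀ C : (ι → A) → κ, ∃ e, (l e).IsMono C

theorem HasSparseLines.exists_injective {p : ℕ} {κ A : Type} [Fintype A]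
    (h : HasSparseLines p κ A) :
    ∃ (ι E : Type) (_ : Fintype ι) (_ : Fintype E) (l : E → Line A ι), Function.Injective l ∧
      SparseFamily p (fun e => linePoints (l e)) ∧ ∀ C : (ι → A) → κ, ∃ e, (l e).IsMono C := by
  classical
  obtain ⟨ι, E, _, _, l, hsp, hcol⟩ := h
  choose s hs using fun y : Set.range l => y.2
  have hinj : Function.Injective s := fun y z h => Subtype.ext (by rw [← hs y, h, hs z])
  refine ⟨ι, Set.range l, inferInstance, Fintype.ofFinite _, fun y => y.1,
    Subtype.val_injective, ?_, fun C => ?_⟩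
  · convert hsp.comp_injective hinj using 2 with y
    simp [hs]
  · obtain ⟨e, he⟩ := hcol C
    exact ⟨⟨l e, e, rfl⟩, he⟩

/-- A picture over the cube `A ^ m` for a set `s` of points of that cube: a `q`-sparse family of
lines in a cube `A ^ (m ⊕ ι)` that project to lines of `A ^ m`, such that each colouring constant
on the fibres of the points outside `s` has a monochromatic line in the family. -/
def HasPicture (q : ℕ) (κ A m : Type) [Fintype A] [Fintype m] (s : Finset (m → A)) : Prop :=
  ∃ (ι E : Type) (_ : Fintype ι) (_ : Fintype E) (l : E → Line A (m ⊕ ι)),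
    (∀ e, ∃ i, (l e).idxFun (Sum.inl i) = none) ∧
    SparseFamily q (fun e => linePoints (l e)) ∧
    ∀ C : (m ⊕ ι → A) → κ,
      (∀ v w : m ⊕ ι → A, v ∘ Sum.inl = w ∘ Sum.inl → v ∘ Sum.inl ∉ s → C v = C w) →
      ∃ e, (l e).IsMono C

/-- The initial picture consists of disjoint lifts of all lines of `A ^ m`, told apart by constant
values in additional coordinates. -/
theorem hasPicture_empty (q : ℕ) {κ A m : Type} [Fintype A] [Nontrivial A] [Fintype m]
    (hm : ∀ C : (m → A) → κ, ∃ l : Line A m, l.IsMono C) : HasPicture q κ A m ∅ := by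
  classical
  obtain ⟨a₀, a₁, ha⟩ := exists_pair_ne A
  let tag : Line A m → Line A m → A := fun l k => if k = l then a₁ else a₀
  have htag : Function.Injective tag := by
    intro l l' h
    by_contra hne
    have := congrFun h l
    simp [tag, hne, ha.symm] at this
  refine ⟨Line A m, Line A m, Fintype.ofFinite _, Fintype.ofFinite _,
    fun l => l.horizontal (tag l), fun l => l.proper, ?_, ?_⟩
  · refine SparseFamily.of_sum_card_lt fun M hM _ => ?_
    rw [Finset.card_biUnion]
    · have := hM.card_pos
      omega
    · intro l _ l' _ hne
      rw [Function.onFun, Finset.disjoint_left]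
      intro y hy hy'
      obtain ⟨a, rfl⟩ := mem_linePoints.1 hy
      obtain ⟨a', h⟩ := mem_linePoints.1 hy'
      rw [Line.horizontal_apply, Line.horizontal_apply] at h
      exact hne (htag (by simpa using (congrArg (· ∘ Sum.inr) h).symm))
  · intro C hC
    obtain ⟨l, c, hl⟩ := hm fun x => C (Sum.elim x fun _ => a₀)
    refine ⟨l, c, fun a => ?_⟩
    rw [← hl a, Line.horizontal_apply]
    exact hC _ _ (by simp) (by simp)

/-- Amalgamating copies of a picture along the fibre over `x`. -/
theorem HasPicture.insert {p q : ℕ} (hqp : q ≤ 2 * p) {κ A m : Type} [Fintype A] [Nonempty A]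
    [Fintype m] [DecidableEq (m → A)]
    (hp : ∀ (B : Type) [Fintype B], Nonempty B → HasSparseLines p κ B)
    {s : Finset (m → A)} (hs : HasPicture q κ A m s) (x : m → A) :
    HasPicture q κ A m (insert x s) := by
  classical
  obtain ⟨ι, E, _, _, l, hl, hsp, hcol⟩ := hs
  obtain ⟨N, I, _, _, L, hLinj, hLsp, hLcol⟩ := (hp (ι → A) inferInstance).exists_injective
  refine ⟨N × (m ⊕ ι), I × E, inferInstance, inferInstance,
    fun k => lineCopy x (L k.1) (l k.2) (hl k.2), fun k => hl k.2, ?_, ?_⟩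
  · have h := hsp.amalgam (hLsp.map ⟨_, fibrePoint_injective x⟩) hqp (fun v => v ∘ Sum.inl = x)
      (fun i => ⟨cubeCopy x (L i), cubeCopy_injective x (L i)⟩)
      (fun i j v w hvw hij => comp_inl_eq_of_cubeCopy_eq hvw (hLinj.ne hij)) ?_ ?_
    · convert h using 2 with k
      ext y
      simp [mem_linePoints, lineCopy_apply]
    · rintro i v rfl
      simp only [Finset.mem_map, mem_linePoints]
      refine ⟨_, ⟨v ∘ Sum.inr, rfl⟩, ?_⟩
      change fibrePoint _ _ = cubeCopy _ _ _
      rw [← cubeCopy_sumElim, Sum.elim_comp_inl_inr]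
    · intro e v hv w hw hvx hwx
      obtain ⟨a, rfl⟩ := mem_linePoints.1 hv
      obtain ⟨b, rfl⟩ := mem_linePoints.1 hw
      obtain ⟨i, hi⟩ := hl e
      have hab : a = b := by simpa [hi] using congrFun (hvx.trans hwx.symm) i
      rw [hab]
  · intro C hC
    obtain ⟨i, c, hi⟩ := hLcol fun y => C (fibrePoint x y)
    obtain ⟨e, c', he⟩ := hcol (fun v => C (cubeCopy x (L i) v)) (by
      intro v w hvw hv
      by_cases hx : v ∘ Sum.inl = x
      · have hv' : v = Sum.elim x (v ∘ Sum.inr) := by rw [← hx, Sum.elim_comp_inl_inr]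
        have hw' : w = Sum.elim x (w ∘ Sum.inr) := by rw [← hx, hvw, Sum.elim_comp_inl_inr]
        rw [hv', hw', cubeCopy_sumElim, cubeCopy_sumElim]
        exact (hi _).trans (hi _).symm
      · exact hC _ _ hvw (by simpa [hx] using ⟨hx, hv⟩))
    exact ⟨(i, e), c', fun a => by rw [lineCopy_apply]; exact he a⟩

/-- A sparse Hales–Jewett theorem. Every family is `1`-sparse, so the induction starts from the
Hales–Jewett theorem; since `p + 2 ≤ 2 * (p + 1)`, amalgamation increases the sparsity. -/
theorem hasSparseLines (p : ℕ) (κ : Type) [Finite κ] :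
    ∀ (A : Type) [Fintype A], Nonempty A → HasSparseLines (p + 1) κ A := by
  classical
  induction p with
  | zero =>
    intro A _ _
    obtain ⟨ι, _, h⟩ := Line.exists_mono_in_high_dimension A κ
    refine ⟨ι, Line A ι, inferInstance, Fintype.ofFinite _, id, ?_, h⟩
    refine SparseFamily.of_sum_card_lt fun M hM hM1 => ?_
    obtain ⟨l, rfl⟩ := Finset.card_eq_one.1 (le_antisymm hM1 hM.card_pos)
    simp
  | succ p ih =>
    intro A _ _
    rcases subsingleton_or_nontrivial A with hA | hA
    · refine ⟨Unit, Unit, inferInstance, inferInstance, fun _ => Line.diagonal A Unit, ?_,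
        fun C => ⟨(), C fun _ => Classical.arbitrary A, fun a => ?_⟩⟩
      · refine SparseFamily.of_sum_card_lt fun M hM _ => ?_
        obtain rfl : M = {()} := by
          obtain ⟨u, hu⟩ := hM
          ext v
          simpa using hu
        simp
      · congr 1
        exact Subsingleton.elim _ _
    · obtain ⟨m, _, hm⟩ := Line.exists_mono_in_high_dimension A κ
      have hpic : ∀ s : Finset (m → A), HasPicture (p + 1 + 1) κ A m s := by
        intro s
        induction s using Finset.induction_on with
        | empty => exact hasPicture_empty _ hm
        | insert x s _ hs => exact hs.insert (by omega) ih x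
      obtain ⟨ι, E, _, _, l, -, hsp, hcol⟩ := hpic Finset.univ
      exact ⟨m ⊕ ι, E, inferInstance, inferInstance, l, hsp, fun C =>
        hcol C fun v _ _ hv => absurd (Finset.mem_univ _) hv⟩

/-! ### Generic choices in Minkowski space -/

theorem SparseFamily.of_forall_exists {V E I : Type*} {p : ℕ} {f : E → Finset V} {g : I → Finset V}
    (hf : SparseFamily p f) (hg : Function.Injective g) (h : ∀ i, ∃ e, f e = g i) :
    SparseFamily p g := by
  choose s hs using h
  have hinj : Function.Injective s := fun i j hij => hg (by rw [← hs, hij, hs])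
  have := hf.comp_injective hinj
  rwa [show f ∘ s = g from funext hs] at this

/-- If for each pair of indices every choice at one of them rules out finitely many choices at the
other, then choices from an infinite set can be made for all indices. -/
theorem exists_forall_not_of_finite {E X : Type*} [Finite E] {S : Set X} (hS : S.Infinite)
    (R : E → X → E → X → Prop) (hsymm : ∀ e x e' y, R e x e' y → R e' y e x)
    (hfin : ∀ e e', e ≠ e' → ∀ y ∈ S, {x | x ∈ S ∧ R e x e' y}.Finite) :
    ∃ f : E → X, (∀ e, f e ∈ S) ∧ ∀ e e', e ≠ e' → ¬ R e (f e) e' (f e') := by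
  classical
  have := Fintype.ofFinite E
  suffices h : ∀ s : Finset E, ∃ f : E → X, (∀ e, f e ∈ S) ∧
      ∀ e ∈ s, ∀ e' ∈ s, e ≠ e' → ¬ R e (f e) e' (f e') by
    obtain ⟨f, hf, h⟩ := h Finset.univ
    exact ⟨f, hf, fun e e' => h e (Finset.mem_univ _) e' (Finset.mem_univ _)⟩
  intro s
  induction s using Finset.induction_on with
  | empty =>
    obtain ⟨x, hx⟩ := hS.nonempty
    exact ⟨fun _ => x, fun _ => hx, by simp⟩
  | insert a s ha ih =>
    obtain ⟨f, hf, h⟩ := ih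
    have hbad : (⋃ e ∈ s, {x | x ∈ S ∧ R a x e (f e)}).Finite :=
      s.finite_toSet.biUnion fun e he => hfin a e (by rintro rfl; exact ha he) _ (hf e)
    obtain ⟨x, hxS, hx⟩ := (hS.sdiff hbad).nonempty
    have hx' : ∀ e ∈ s, ¬ R a x e (f e) := fun e he hR =>
      hx (Set.mem_biUnion (show e ∈ (s : Set E) from he) ⟨hxS, hR⟩)
    have hup : ∀ e ∈ s, Function.update f a x e = f e := fun e he =>
      Function.update_of_ne (by rintro rfl; exact ha he) _ _
    refine ⟨Function.update f a x, fun e => ?_, fun e he e' he' hne => ?_⟩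
    · by_cases hea : e = a
      · subst hea; simpa using hxS
      · simpa [hea] using hf e
    · rcases Finset.mem_insert.1 he with rfl | hes
      · rcases Finset.mem_insert.1 he' with rfl | hes'
        · exact absurd rfl hne
        · rw [hup e' hes', Function.update_self]
          exact hx' e' hes'
      · rcases Finset.mem_insert.1 he' with rfl | hes'
        · rw [hup e hes, Function.update_self]
          exact fun hR => hx' e hes (hsymm _ _ _ _ hR)
        · rw [hup e hes, hup e' hes']
          exact h e hes e' hes' hne

/-- A linear functional that vanishes on no nonzero vector with coordinates in a given finite set. -/
theorem exists_linearMap_ne_zero {ι : Type*} [Finite ι] (D : Finset ℝ) :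
    ∃ F : (ι → ℝ) →ₗ[ℝ] ℝ, ∀ d : ι → ℝ, (∀ i, d i ∈ D) → d ≠ 0 → F d ≠ 0 := by
  have := Fintype.ofFinite ι
  obtain ⟨F, hF⟩ := Module.exists_dual_forall_apply_ne_zero (K := ℝ) (M := ι → ℝ)
    (fun d : {d : ι → D // (fun i => (d i : ℝ)) ≠ 0} => fun i => (d.1 i : ℝ)) fun d => d.2
  exact ⟨F, fun d hd h0 => hF ⟨fun i => ⟨d i, hd i⟩, h0⟩⟩

theorem infinite_norm_eq_one : {ω : ℂ | ‖ω‖ = 1}.Infinite := by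
  have h : Set.InjOn (fun x : ℝ => Complex.exp (x * Complex.I)) (Set.Ioc 0 1) := by
    intro x hx y hy hxy
    have hpi := Real.pi_gt_three
    have h1 := congrArg Complex.arg hxy
    simp only [Complex.arg_exp_mul_I] at h1
    rwa [toIocMod_eq_self Real.two_pi_pos |>.2, toIocMod_eq_self Real.two_pi_pos |>.2] at h1
    · exact ⟨by linarith [hy.1], by linarith [hy.2]⟩
    · exact ⟨by linarith [hx.1], by linarith [hx.2]⟩
  refine ((Set.Ioc_infinite one_pos).image h).mono ?_
  rintro _ ⟨x, -, rfl⟩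
  exact Complex.norm_exp_ofReal_mul_I x

/-- A line meets the unit circle in finitely many points. -/
theorem finite_re_mul_eq {b : ℂ} (hb : b ≠ 0) (c : ℝ) :
    {ω : ℂ | ‖ω‖ = 1 ∧ (ω * b).re = c}.Finite := by
  -- on the unit circle, the equation becomes quadratic after multiplication by `ω`
  let p : Polynomial ℂ := .C b * .X ^ 2 + .C (-(2 * c : ℂ)) * .X + .C (starRingEnd ℂ b)
  have hp : p ≠ 0 := by
    intro h
    have := Polynomial.natDegree_quadratic (b := (-(2 * c : ℂ))) (c := starRingEnd ℂ b) hb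
    change p.natDegree = 2 at this
    simp [h] at this
  refine (p.rootSet_finite ℂ).subset ?_
  rintro ω ⟨h1, h2⟩
  rw [Polynomial.mem_rootSet]
  refine ⟨hp, ?_⟩
  have hω : ω * starRingEnd ℂ ω = 1 := by rw [Complex.mul_conj']; simp [h1]
  have hre : ω * b + starRingEnd ℂ ω * starRingEnd ℂ b = 2 * c := by
    rw [← map_mul, Complex.add_conj, h2]; push_cast; ring
  simp only [p, map_add, map_mul, Polynomial.aeval_C, Polynomial.aeval_X, map_pow,
    Algebra.algebraMap_self, RingHom.id_apply]
  linear_combination ω * hre - starRingEnd ℂ b * hω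

/-- Two circles with different centers meet in finitely many points. -/
theorem finite_norm_mul_sub_eq {u u' : ℂ} (hu : u ≠ 0) (hu' : u' ≠ 0) (c : ℝ) :
    {ω : ℂ | ‖ω‖ = 1 ∧ ‖ω * u - u'‖ = c}.Finite := by
  refine (finite_re_mul_eq (b := u * starRingEnd ℂ u') (by simp [hu, hu'])
    ((‖u‖ ^ 2 + ‖u'‖ ^ 2 - c ^ 2) / 2)).subset ?_
  rintro ω ⟨h1, rfl⟩
  refine ⟨h1, ?_⟩
  have h := Complex.normSq_sub (ω * u) u'
  simp only [Complex.normSq_eq_norm_sq, norm_mul, h1, one_mul] at h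
  rw [h, ← mul_assoc]
  ring

theorem tendsto_norm_add_sub (z : ℂ) :
    Filter.Tendsto (fun τ : ℝ => ‖z + τ‖ - τ) Filter.atTop (nhds z.re) := by
  have h0 : Filter.Tendsto (fun τ : ℝ => z.im ^ 2 / (τ + z.re) + z.re) Filter.atTop
      (nhds (0 + z.re)) :=
    ((tendsto_const_nhds (x := z.im ^ 2)).div_atTop
      (Filter.tendsto_atTop_add_const_right _ _ Filter.tendsto_id)).add_const _
  rw [zero_add] at h0
  refine tendsto_of_tendsto_of_tendsto_of_le_of_le' tendsto_const_nhds h0 ?_ ?_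
  · filter_upwards with τ
    have := Complex.re_le_norm (z + τ)
    simp at this
    linarith
  · filter_upwards [Filter.eventually_gt_atTop (-z.re)] with τ hτ
    have hpos : 0 < τ + z.re := by linarith
    have h1 : ‖z + τ‖ ^ 2 = (τ + z.re) ^ 2 + z.im ^ 2 := by
      rw [← Complex.normSq_eq_norm_sq, Complex.normSq_apply]
      simp
      ring
    have h2 : ‖z + τ‖ ≤ τ + z.re + z.im ^ 2 / (τ + z.re) := by
      refine le_of_sq_le_sq ?_ (by positivity)
      rw [h1, add_sq (τ + z.re)]
      have : 2 * (τ + z.re) * (z.im ^ 2 / (τ + z.re)) = 2 * z.im ^ 2 := by field_simp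
      rw [this]
      nlinarith [sq_nonneg z.im, sq_nonneg (z.im ^ 2 / (τ + z.re))]
    linarith

/-- Two points of `ℂ × ℝ`, regarded as Minkowski space, are null separated. When a point `(z, r)`
stands for the circle with center `z` and radius `r`, this is internal tangency or equality. -/
def NullSep (p q : ℂ × ℝ) : Prop := ‖p.1 - q.1‖ = |p.2 - q.2|

theorem NullSep.symm {p q : ℂ × ℝ} (h : NullSep p q) : NullSep q p := by
  rw [NullSep, norm_sub_rev, abs_sub_comm]
  exact h

/-- The graph of null separation of a family of points. -/
def nullGraph {V : Type*} (φ : V → ℂ × ℝ) : SimpleGraph V where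
  Adj v w := v ≠ w ∧ NullSep (φ v) (φ w)
  symm := ⟨fun _ _ h => ⟨h.1.symm, h.2.symm⟩⟩
  loopless := ⟨fun _ h => h.1 rfl⟩

/-- A graph is `q`-sparse if the family of its edges is, that is, it has no cycle of length at most
`q`. -/
def SparseGraph {V : Type*} (q : ℕ) (G : SimpleGraph V) : Prop :=
  SparseFamily q (fun s : {s : Finset V // ∃ v w, G.Adj v w ∧ (s : Set V) = {v, w}} => s.1)

/-- The null cone of `(z, r)` meets the axis `{0} × ℝ` at the heights `r ± ‖z‖`. After a rotation
and a long translation of `ℂ`, which do not change null separation, the upper heights of the points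
of a family are distinct, and no lower height is an upper height. -/
theorem exists_general_position {V : Type*} [Finite V] {φ : V → ℂ × ℝ}
    (hφ : Function.Injective φ) :
    ∃ (z : V → ℂ) (r : V → ℝ), Function.Injective (fun v => (z v, r v)) ∧
      nullGraph (fun v => (z v, r v)) = nullGraph φ ∧ (∀ v, z v ≠ 0) ∧
      Function.Injective (fun v => r v + ‖z v‖) ∧ ∀ v w, r v - ‖z v‖ ≠ r w + ‖z w‖ := by
  -- a rotation separating the limits, up to the common term `τ`, of the upper heights as the
  -- translation length `τ` tends to infinity
  obtain ⟨ω, hω, hsep⟩ : ∃ ω : ℂ, ‖ω‖ = 1 ∧ ∀ v w, v ≠ w →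
      (ω * (φ v).1).re + (φ v).2 ≠ (ω * (φ w).1).re + (φ w).2 := by
    have hfin : (⋃ x : {x : V × V // (φ x.1).1 ≠ (φ x.2).1}, {ω : ℂ | ‖ω‖ = 1 ∧
        (ω * ((φ x.1.1).1 - (φ x.1.2).1)).re = (φ x.1.2).2 - (φ x.1.1).2}).Finite :=
      Set.finite_iUnion fun x => finite_re_mul_eq (sub_ne_zero.2 x.2) _
    obtain ⟨ω, hω, hx⟩ := (infinite_norm_eq_one.sdiff hfin).nonempty
    refine ⟨ω, hω, fun v w hvw heq => ?_⟩
    by_cases hz : (φ v).1 = (φ w).1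
    · refine hvw (hφ (Prod.ext hz ?_))
      rw [hz] at heq
      linarith
    · refine hx (Set.mem_iUnion.2 ⟨⟨(v, w), hz⟩, hω, ?_⟩)
      rw [mul_sub, Complex.sub_re]
      linarith
  have hlim : ∀ v, Filter.Tendsto (fun τ : ℝ => (φ v).2 + ‖ω * (φ v).1 + τ‖ - τ) Filter.atTop
      (nhds ((ω * (φ v).1).re + (φ v).2)) := fun v =>
    ((tendsto_norm_add_sub (ω * (φ v).1)).add_const _).congr fun τ => by ring
  have hinf : ∀ v, Filter.Tendsto (fun τ : ℝ => ‖ω * (φ v).1 + τ‖) Filter.atTop Filter.atTop :=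
    fun v => ((tendsto_norm_add_sub (ω * (φ v).1)).add_atTop Filter.tendsto_id).congr
      fun τ => by simp
  have h1 : ∀ᶠ τ : ℝ in Filter.atTop, ∀ v w, v ≠ w →
      (φ v).2 + ‖ω * (φ v).1 + τ‖ ≠ (φ w).2 + ‖ω * (φ w).1 + τ‖ := by
    simp only [Filter.eventually_all]
    intro v w hvw
    filter_upwards [((hlim v).sub (hlim w)).eventually_ne (sub_ne_zero.2 (hsep v w hvw))]
      with τ hτ heq
    exact hτ (by rw [heq]; ring)
  have h2 : ∀ᶠ τ : ℝ in Filter.atTop, ∀ v, 0 < ‖ω * (φ v).1 + τ‖ :=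
    Filter.eventually_all.2 fun v => (hinf v).eventually_gt_atTop 0
  have h3 : ∀ᶠ τ : ℝ in Filter.atTop, ∀ v w : V, (φ v).2 - (φ w).2 < ‖ω * (φ v).1 + τ‖ :=
    Filter.eventually_all.2 fun v => Filter.eventually_all.2 fun w =>
      (hinf v).eventually_gt_atTop _
  obtain ⟨τ, h1, h2, h3⟩ := (h1.and (h2.and h3)).exists
  have hω0 : ω ≠ 0 := norm_ne_zero_iff.1 (by rw [hω]; exact one_ne_zero)
  refine ⟨fun v => ω * (φ v).1 + τ, fun v => (φ v).2, ?_, ?_, fun v => norm_pos_iff.1 (h2 v), ?_,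
    fun v w h => ?_⟩
  · intro v w h
    simp only [Prod.mk.injEq, add_left_inj, mul_right_inj' hω0] at h
    exact hφ (Prod.ext h.1 h.2)
  · ext v w
    simp [nullGraph, NullSep, ← mul_sub, hω]
  · intro v w h
    by_contra hvw
    exact h1 v w hvw h
  · have := h3 v w
    have := h2 w
    linarith

/-! ### Raising the chromatic number -/

/-- The graph consisting of an independent set, the cube `V ^ ι`, and one copy of `G` for each index
`e`, with the vertex `v` of that copy joined to the point `l e v` of the line `l e`. -/
def attachCopies {V ι E : Type*} (G : SimpleGraph V) (l : E → Line V ι) :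
    SimpleGraph ((ι → V) ⊕ (E × V)) where
  Adj
    | .inl _, .inl _ => False
    | .inl x, .inr p => x = l p.1 p.2
    | .inr p, .inl x => x = l p.1 p.2
    | .inr p, .inr p' => p.1 = p'.1 ∧ G.Adj p.2 p'.2
  symm := ⟨by
    rintro (x | p) (y | p') h
    · exact h
    · exact h
    · exact h
    · exact ⟨h.1.symm, h.2.symm⟩⟩
  loopless := ⟨by
    rintro (x | p) h
    · exact h
    · exact h.2.ne rfl⟩

/-- The edges of `attachCopies G l` form an amalgam of copies of `G` with pendant edges, the ends of
the pendant edges in the copy `e` being glued to the points of the line `l e`. -/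
theorem SparseGraph.attachCopies {V ι E : Type*} [Fintype V] {G : SimpleGraph V} {q p : ℕ}
    (hG : SparseGraph q G) (hqp : q ≤ 2 * p) {l : E → Line V ι}
    (hl : SparseFamily p fun e => linePoints (l e)) : SparseGraph q (attachCopies G l) := by
  classical
  let c : E → V ⊕ V ↪ (ι → V) ⊕ (E × V) := fun e =>
    ⟨Sum.map (l e) fun v => (e, v), (line_injective (l e)).sumMap fun v w h => congrArg Prod.snd h⟩
  have hcl : ∀ e v, c e (.inl v) = .inl (l e v) := fun _ _ => rfl
  have hcr : ∀ e v, c e (.inr v) = .inr (e, v) := fun _ _ => rfl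
  have h := hG.pendant.amalgam (hl.map (Function.Embedding.inl : _ ↪ (ι → V) ⊕ (E × V)))
    hqp (fun v => v.isLeft = true) c ?_ ?_ ?_
  · refine h.of_forall_exists Subtype.val_injective ?_
    suffices hmain : ∀ p q, (_root_.attachCopies G l).Adj p q → p.isLeft ∨ q.isRight →
        ∀ s : Finset ((ι → V) ⊕ (E × V)), (s : Set _) = {p, q} → ∃ x : E × (_ ⊕ V), _ = s by
      rintro ⟨s, p, q, hpq, hs⟩
      by_cases hlr : p.isLeft ∨ q.isRight
      · exact hmain p q hpq hlr s hs
      · refine hmain q p hpq.symm ?_ s (hs.trans (Set.pair_comm _ _))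
        rcases p with p | p <;> rcases q with q | q <;> simp_all
    rintro (x | ⟨e, v⟩) (y | ⟨e', w⟩) hpq hlr s hs
    · exact hpq.elim
    · obtain rfl : x = l e' w := hpq
      refine ⟨(e', .inr w), Finset.coe_injective ?_⟩
      rw [hs]
      simp [hcl, hcr]
    · simp at hlr
    · obtain ⟨rfl, hvw⟩ : e = e' ∧ G.Adj v w := hpq
      refine ⟨(e, .inl ⟨{v, w}, v, w, hvw, by simp⟩), Finset.coe_injective ?_⟩
      rw [hs]
      simp [hcr]
  · rintro e e' (v | v) (w | w) h hne
    · rfl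
    · rw [hcl, hcr] at h
      cases h
    · rw [hcl, hcr] at h
      cases h
    · rw [hcr, hcr] at h
      exact absurd (congrArg Prod.fst (Sum.inr_injective h)) hne
  · rintro e (v | v) hv
    · rw [hcl]
      exact Finset.mem_map_of_mem Function.Embedding.inl (mem_linePoints.2 ⟨v, rfl⟩)
    · cases hv
  · rintro (s | u) (v | v) hv (w | w) hw hvl hwl
    · simp at hv
    · cases hwl
    · cases hvl
    · cases hvl
    · have h1 : v = u := by simpa using hv
      have h2 : w = u := by simpa using hw
      rw [h1, h2]
    · cases hwl
    · cases hvl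
    · cases hvl

/-- If the points `l e v` all have the same colour, then this colour is missing on the copy of `G`
with index `e`. -/
theorem not_colorable_attachCopies {V ι E : Type*} {G : SimpleGraph V} {k : ℕ}
    (hG : ¬ G.Colorable k) {l : E → Line V ι}
    (hl : ∀ C : (ι → V) → Fin (k + 1), ∃ e, (l e).IsMono C) :
    ¬ (attachCopies G l).Colorable (k + 1) := by
  classical
  rintro ⟨C⟩
  obtain ⟨e, c, he⟩ := hl fun x => C (.inl x)
  have hadj : ∀ v, (attachCopies G l).Adj (.inl (l e v)) (.inr (e, v)) := fun _ => rfl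
  let C' : G.Coloring {y : Fin (k + 1) // y ≠ c} :=
    SimpleGraph.Coloring.mk
      (fun v => ⟨C (.inr (e, v)), fun h => C.valid (hadj v) ((he v).trans h.symm)⟩)
      fun {v w} hvw h => C.valid (show (attachCopies G l).Adj (.inr (e, v)) (.inr (e, w)) from
        ⟨rfl, hvw⟩) (congrArg Subtype.val h)
  have := C'.colorable
  rw [Fintype.card_subtype_compl, Fintype.card_fin, Fintype.card_subtype_eq,
    Nat.add_sub_cancel] at this
  exact hG this

/-- There is a finite family of distinct points of Minkowski space such that the graph of null
separation is `q`-sparse and not `k`-colourable. -/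
def HasNullFamily (q k : ℕ) : Prop :=
  ∃ (V : Type) (_ : Fintype V) (φ : V → ℂ × ℝ), Function.Injective φ ∧
    SparseGraph q (nullGraph φ) ∧ ¬ (nullGraph φ).Colorable k

theorem hasNullFamily_zero (q : ℕ) : HasNullFamily q 0 := by
  refine ⟨Unit, inferInstance, fun _ => 0, fun _ _ _ => rfl, ?_, fun ⟨C⟩ => (C ()).elim0⟩
  intro M ⟨⟨s, v, w, h, _⟩, _⟩
  exact absurd rfl h.1

/-- Put the points of a cube on the axis `{0} × ℝ`, so that combinatorial lines over the alphabet `V`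
become homothetic copies of the set of upper heights of the given family. For each line of a sparse
Hales–Jewett family, add the image of the given family under the same homothety, rotated about the
axis. Generic choices make null separation the adjacency of `attachCopies`. -/
theorem HasNullFamily.succ {q k : ℕ} (h : HasNullFamily q k) : HasNullFamily q (k + 1) := by
  classical
  obtain ⟨V, _, φ, hφ, hsp, hcol⟩ := h
  have hVne : Nonempty V := by
    by_contra hV
    rw [not_nonempty_iff] at hV
    exact hcol ⟨SimpleGraph.Coloring.mk (fun v => isEmptyElim v) fun {v} => isEmptyElim v⟩
  obtain ⟨z, r, hinj, hgraph, hz, ht, hst⟩ := exists_general_position hφ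
  rw [← hgraph] at hsp hcol
  set t : V → ℝ := fun v => r v + ‖z v‖ with ht_def
  obtain ⟨ι, E, _, _, l, hLsp, hLcol⟩ := hasSparseLines q (Fin (k + 1)) V hVne
  -- the functional `F` maps words with letters `t v` to the axis; it keeps them apart from each
  -- other and from words with letters `r v - ‖z v‖` at the active places of a line; the letters
  -- `0` and `1` ensure that the ratio `lam e` of a homothety is nonzero
  obtain ⟨F, hF⟩ := exists_linearMap_ne_zero (ι := ι)
    (insert 1 (Finset.univ.image (fun p : V × V => t p.1 - t p.2) ∪
      Finset.univ.image (fun p : V × V => r p.1 - ‖z p.1‖ - t p.2)) ∪ {0})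
  let a : E → ℝ := fun e => F fun i => ((l e).idxFun i).elim 0 t
  let lam : E → ℝ := fun e => F fun i => ((l e).idxFun i).elim 1 fun _ => 0
  let X : (ι → V) → ℝ := fun x => F fun i => t (x i)
  have hlin : ∀ e c, a e + lam e * c = F fun i => ((l e).idxFun i).elim c t := by
    intro e c
    simp only [a, lam]
    rw [mul_comm, ← smul_eq_mul c, ← map_smul, ← map_add]
    congr 1
    funext i
    cases h : (l e).idxFun i <;> simp [h]
  have hlam : ∀ e, lam e ≠ 0 := by
    intro e
    refine hF _ (fun i => ?_) fun h0 => ?_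
    · cases h : (l e).idxFun i <;> simp
    · obtain ⟨i, hi⟩ := (l e).proper
      simpa [hi] using congrFun h0 i
  have hXl : ∀ e v, X (l e v) = a e + lam e * t v := by
    intro e v
    rw [hlin]
    simp only [X]
    congr 1
    funext i
    cases h : (l e).idxFun i <;> simp [h]
  have hX : Function.Injective X := by
    intro x y hxy
    by_contra hne
    refine hF (fun i => t (x i) - t (y i)) (fun i => ?_) (fun h0 => hne ?_) ?_
    · simp
    · funext i
      exact ht (sub_eq_zero.1 (congrFun h0 i))
    · have : (fun i => t (x i) - t (y i)) = (fun i => t (x i)) - fun i => t (y i) := rfl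
      rw [this, map_sub, sub_eq_zero]
      exact hxy
  have hXs : ∀ e v x, X x ≠ a e + lam e * (r v - ‖z v‖) := by
    intro e v x hx
    refine hF (fun i => ((l e).idxFun i).elim (r v - ‖z v‖) t - t (x i)) (fun i => ?_)
      (fun h0 => ?_) ?_
    · cases h : (l e).idxFun i <;> simp
    · obtain ⟨i, hi⟩ := (l e).proper
      have := congrFun h0 i
      simp only [hi, Option.elim, Pi.zero_apply] at this
      exact hst v (x i) (sub_eq_zero.1 this)
    · have : (fun i => ((l e).idxFun i).elim (r v - ‖z v‖) t - t (x i))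
          = (fun i => ((l e).idxFun i).elim (r v - ‖z v‖) t) - fun i => t (x i) := rfl
      rw [this, map_sub, ← hlin, ← hx, sub_self]
  -- rotations that keep different copies from touching
  obtain ⟨ω, hω, hsep⟩ := exists_forall_not_of_finite (E := E) infinite_norm_eq_one
    (fun e x e' y => ∃ v w, NullSep (x * (lam e * z v), a e + lam e * r v)
      (y * (lam e' * z w), a e' + lam e' * r w))
    (fun _ _ _ _ ⟨v, w, h⟩ => ⟨w, v, h.symm⟩) (by
      intro e e' _ y hy
      refine (Set.finite_iUnion fun p : V × V => finite_norm_mul_sub_eq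
        (u := lam e * z p.1) (u' := y * (lam e' * z p.2)) ?_ ?_
        |a e + lam e * r p.1 - (a e' + lam e' * r p.2)|).subset ?_
      · simp [hlam, hz]
      · have : y ≠ 0 := norm_ne_zero_iff.1 (by rw [show ‖y‖ = 1 from hy]; exact one_ne_zero)
        simp [hlam, hz, this]
      · rintro x ⟨hx, v, w, h⟩
        exact Set.mem_iUnion.2 ⟨(v, w), hx, h⟩)
  have hω' : ∀ e, ‖ω e‖ = 1 := hω
  let Φ : (ι → V) ⊕ (E × V) → ℂ × ℝ := Sum.elim (fun x => (0, X x))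
    fun p => (ω p.1 * (lam p.1 * z p.2), a p.1 + lam p.1 * r p.2)
  have haxis : ∀ x y, NullSep (Φ (.inl x)) (Φ (.inl y)) → x = y := by
    intro x y h
    simp only [NullSep, Φ, Sum.elim_inl, sub_self, norm_zero] at h
    exact hX (sub_eq_zero.1 (abs_eq_zero.1 h.symm))
  have hcross : ∀ x e v, NullSep (Φ (.inl x)) (Φ (.inr (e, v))) ↔ x = l e v := by
    intro x e v
    have h1 : ‖(0 : ℂ) - ω e * (lam e * z v)‖ = |lam e * ‖z v‖| := by
      simp [hω', abs_mul]
    simp only [NullSep, Φ, Sum.elim_inl, Sum.elim_inr]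
    rw [h1, abs_eq_abs]
    constructor
    · rintro (h | h)
      · refine hX ?_
        rw [hXl]
        simp only [ht_def]
        linarith
      · exact absurd (by linarith) (hXs e v x)
    · rintro rfl
      left
      rw [hXl]
      simp only [ht_def]
      ring
  have hcopy : ∀ e v w, NullSep (Φ (.inr (e, v))) (Φ (.inr (e, w))) ↔
      NullSep (z v, r v) (z w, r w) := by
    intro e v w
    simp only [NullSep, Φ, Sum.elim_inr]
    rw [← mul_sub, ← mul_sub, norm_mul, norm_mul, hω', one_mul, add_sub_add_left_eq_sub,
      ← mul_sub, abs_mul, Complex.norm_real, Real.norm_eq_abs,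
      mul_right_inj' (abs_ne_zero.2 (hlam e))]
  have hcopies : ∀ e v e' w, NullSep (Φ (.inr (e, v))) (Φ (.inr (e', w))) → e = e' := by
    intro e v e' w h
    by_contra hne
    exact hsep e e' hne ⟨v, w, h⟩
  have hΦ : nullGraph Φ = attachCopies (nullGraph fun v => (z v, r v)) l := by
    ext p q
    rcases p with x | ⟨e, v⟩ <;> rcases q with y | ⟨e', w⟩
    · exact ⟨fun h => h.1 (congrArg _ (haxis x y h.2)), fun h => h.elim⟩
    · exact ⟨fun h => (hcross _ _ _).1 h.2, fun h => ⟨Sum.inl_ne_inr, (hcross _ _ _).2 h⟩⟩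
    · exact ⟨fun h => (hcross _ _ _).1 h.2.symm,
        fun h => ⟨Sum.inr_ne_inl, ((hcross _ _ _).2 h).symm⟩⟩
    · constructor
      · rintro ⟨hne, h⟩
        obtain rfl := hcopies _ _ _ _ h
        exact ⟨rfl, fun hvw => hne (by rw [show v = w from hvw]), (hcopy _ _ _).1 h⟩
      · rintro ⟨rfl, hne, h⟩
        exact ⟨fun heq => hne (congrArg Prod.snd (Sum.inr_injective heq)), (hcopy _ _ _).2 h⟩
  refine ⟨(ι → V) ⊕ (E × V), inferInstance, Φ, ?_, ?_, ?_⟩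
  · have hnull : ∀ p q, Φ p = Φ q → NullSep (Φ p) (Φ q) := by
      intro p q h
      rw [h]
      simp [NullSep]
    have hne : ∀ x p, Φ (.inl x) ≠ Φ (.inr p) := by
      intro x p h
      have h0 := congrArg Prod.fst h
      have : ω p.1 ≠ 0 := norm_ne_zero_iff.1 (by rw [hω']; exact one_ne_zero)
      simp [Φ, hlam, hz, this] at h0
    rintro (x | ⟨e, v⟩) (y | ⟨e', w⟩) h
    · rw [haxis x y (hnull _ _ h)]
    · exact absurd h (hne _ _)
    · exact absurd h.symm (hne _ _)
    · obtain rfl := hcopies _ _ _ _ (hnull _ _ h)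
      have hω0 : ω e ≠ 0 := norm_ne_zero_iff.1 (by rw [hω']; exact one_ne_zero)
      have hvw : v = w := by
        refine hinj ?_
        simpa [Φ, hlam, hω0] using h
      rw [hvw]
  · rw [hΦ]
    exact hsp.attachCopies (by omega) hLsp
  · rw [hΦ]
    exact not_colorable_attachCopies hcol hLcol

theorem hasNullFamily (q k : ℕ) : HasNullFamily q k := by
  induction k with
  | zero => exact hasNullFamily_zero q
  | succ k ih => exact ih.succ

/-! ### From null separation to circles -/

theorem SparseGraph.lt_length_of_isCycle {V : Type*} {G : SimpleGraph V} {q : ℕ}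
    (hG : SparseGraph q G) {u : V} {w : G.Walk u u} (hw : w.IsCycle) : q < w.length := by
  classical
  have hinj : Function.Injective fun e : G.edgeSet => e.1.toFinset := fun e e' h => by
    refine Subtype.ext (Sym2.ext fun x => ?_)
    rw [← Sym2.mem_toFinset, ← Sym2.mem_toFinset]
    exact Finset.ext_iff.1 h x
  have hedge : SparseFamily q fun e : G.edgeSet => e.1.toFinset := by
    refine hG.of_forall_exists hinj ?_
    rintro ⟨⟨v, v'⟩, h⟩
    refine ⟨⟨{v, v'}, v, v', h, by simp⟩, ?_⟩
    ext x
    simp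
  by_contra! hq
  let L : List G.edgeSet := w.edges.attach.map fun e => ⟨e.1, w.edges_subset_edgeSet e.2⟩
  have hL : L.Nodup :=
    (List.nodup_attach.2 hw.isCircuit.isTrail.edges_nodup).map fun e e' h =>
      Subtype.ext (Subtype.mk.inj h)
  have hcard : L.toFinset.card = w.length := by
    rw [List.toFinset_card_of_nodup hL]
    simp [L]
  have hlen := hw.three_le_length
  have hlt := hedge.sum_card_lt (M := L.toFinset)
    (Finset.card_pos.1 (by omega)) (by omega)
  have hsum : ∑ e ∈ L.toFinset, e.1.toFinset.card = 2 * w.length := by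
    rw [Finset.sum_congr rfl fun e _ =>
      Sym2.card_toFinset_of_not_isDiag e.1 (G.not_isDiag_of_mem_edgeSet e.2), Finset.sum_const,
      hcard, smul_eq_mul, mul_comm]
  have hunion : (L.toFinset.biUnion fun e => e.1.toFinset).card ≤ w.length := by
    calc _ ≤ w.support.tail.toFinset.card := by
          refine Finset.card_le_card fun x hx => ?_
          simp only [Finset.mem_biUnion, List.mem_toFinset, Sym2.mem_toFinset, L, List.mem_map] at hx
          obtain ⟨_, ⟨e, -, rfl⟩, hx⟩ := hx
          rw [List.mem_toFinset]
          rcases w.mem_support_iff.1 (w.mem_support_of_mem_edges e.2 hx) with rfl | h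
          · exact SimpleGraph.Walk.end_mem_tail_support hw.not_nil
          · exact h
      _ ≤ w.length := (List.toFinset_card_le _).trans (by simp)
  omega

/-- The circle represented by the point `p`, with all radii increased by `R`. -/
noncomputable def toCircle (R : ℝ) (p : ℂ × ℝ) : Sphere Plane :=
  ⟨Complex.orthonormalBasisOneI.repr p.1, p.2 + R⟩

theorem toCircle_injective (R : ℝ) : Function.Injective (toCircle R) := by
  intro p q h
  have h1 := congrArg Sphere.center h
  have h2 := congrArg Sphere.radius h
  simp only [toCircle, EmbeddingLike.apply_eq_iff_eq, add_left_inj] at h1 h2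
  exact Prod.ext h1 h2

/-- When `R` is large, external tangency does not occur, and tangency is null separation. -/
theorem exists_tangentAt_toCircle_iff {R : ℝ} {p q : ℂ × ℝ} (hp : ‖p.1‖ + |p.2| < R)
    (hq : ‖q.1‖ + |q.2| < R) :
    (∃ x, TangentAt (toCircle R p) (toCircle R q) x) ↔ p ≠ q ∧ NullSep p q := by
  have hdist : dist (toCircle R p).center (toCircle R q).center = ‖p.1 - q.1‖ := by
    simp only [toCircle]
    rw [LinearIsometryEquiv.dist_map, dist_eq_norm]
  have hle := norm_sub_le p.1 q.1
  have hp2 := neg_abs_le p.2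
  have hq2 := neg_abs_le q.2
  have hp1 := norm_nonneg p.1
  have hq1 := norm_nonneg q.1
  constructor
  · rintro ⟨x, hne, h⟩
    refine ⟨fun h => hne (by rw [h]), ?_⟩
    rw [NullSep]
    rcases h with h | h | h
    · have := h.isExtTangent.dist_center
      rw [hdist] at this
      simp only [toCircle] at this
      linarith
    · have := h.isIntTangent.dist_center
      rw [hdist] at this
      simp only [toCircle] at this
      have h0 := norm_nonneg (p.1 - q.1)
      rw [abs_sub_comm, abs_of_nonneg] <;> linarith
    · have := h.isIntTangent.dist_center
      rw [dist_comm, hdist] at this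
      simp only [toCircle] at this
      have h0 := norm_nonneg (p.1 - q.1)
      rw [abs_of_nonneg] <;> linarith
  · rintro ⟨hne, h⟩
    have hne' : toCircle R p ≠ toCircle R q := (toCircle_injective R).ne hne
    rw [NullSep] at h
    rcases le_total p.2 q.2 with hpq | hpq
    · obtain ⟨x, hx⟩ : (toCircle R p).IsIntTangent (toCircle R q) := by
        rw [Sphere.isIntTangent_iff_dist_center, hdist, h, abs_sub_comm,
          abs_of_nonneg (sub_nonneg.2 hpq)]
        simp only [toCircle]
        exact ⟨by ring, by linarith, by linarith⟩
      exact ⟨x, hne', .inr (.inl hx)⟩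
    · obtain ⟨x, hx⟩ : (toCircle R q).IsIntTangent (toCircle R p) := by
        rw [Sphere.isIntTangent_iff_dist_center, dist_comm, hdist, h,
          abs_of_nonneg (sub_nonneg.2 hpq)]
        simp only [toCircle]
        exact ⟨by ring, by linarith, by linarith⟩
      exact ⟨x, hne', .inr (.inr hx)⟩

theorem theorem1 (g k : ℕ) :
    ∃ C : Finset (Sphere Plane), IsConstellation C ∧
      (g : ℕ∞) ≤ (tangencyGraph C).egirth ∧
      (k : ℕ∞) ≤ (tangencyGraph C).chromaticNumber := by
  classical
  obtain ⟨V, _, φ, hφ, hsp, hcol⟩ := hasNullFamily (max g 3) k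
  obtain ⟨R, hR⟩ : ∃ R : ℝ, ∀ v, ‖(φ v).1‖ + |(φ v).2| < R := by
    obtain ⟨R, hR⟩ := (Set.finite_range fun v => ‖(φ v).1‖ + |(φ v).2|).bddAbove
    exact ⟨R + 1, fun v => (hR ⟨v, rfl⟩).trans_lt (lt_add_one R)⟩
  have hinj : Function.Injective fun v => toCircle R (φ v) := (toCircle_injective R).comp hφ
  let C : Finset (Sphere Plane) := Finset.univ.map ⟨_, hinj⟩
  have hC : ∀ s, s ∈ C ↔ ∃ v, toCircle R (φ v) = s := by simp [C]
  have htan : ∀ v w, (∃ x, TangentAt (toCircle R (φ v)) (toCircle R (φ w)) x) ↔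
      (nullGraph φ).Adj v w := fun v w => by
    rw [exists_tangentAt_toCircle_iff (hR v) (hR w), hφ.ne_iff]
    rfl
  let iso : nullGraph φ ≃g tangencyGraph C :=
    { Equiv.ofBijective (fun v => (⟨toCircle R (φ v), (hC _).2 ⟨v, rfl⟩⟩ : {s // s ∈ C}))
        ⟨fun v w h => hinj (congrArg Subtype.val h), fun ⟨s, hs⟩ => by
          obtain ⟨v, rfl⟩ := (hC s).1 hs
          exact ⟨v, rfl⟩⟩ with
      map_rel_iff' := fun {v w} => htan v w }
  have hcycle : ∀ (u : {s // s ∈ C}) (w : (tangencyGraph C).Walk u u), w.IsCycle →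
      max g 3 < w.length := fun u w hw => by
    have := hsp.lt_length_of_isCycle (hw.map (f := iso.symm.toHom) iso.symm.injective)
    rwa [SimpleGraph.Walk.length_map] at this
  refine ⟨C, ⟨?_, ?_⟩, ?_, ?_⟩
  · intro s hs
    obtain ⟨v, rfl⟩ := (hC s).1 hs
    have := hR v
    have := neg_abs_le (φ v).2
    have := norm_nonneg (φ v).1
    simp only [toCircle]
    linarith
  · -- three circles tangent at a common point form a triangle
    rintro s hs t ht u hu x ⟨hst, htu, hsu⟩
    have hclique : (tangencyGraph C).IsNClique 3 {⟨s, hs⟩, ⟨t, ht⟩, ⟨u, hu⟩} :=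
      SimpleGraph.is3Clique_triple_iff.2 ⟨⟨x, hst⟩, ⟨x, hsu⟩, ⟨x, htu⟩⟩
    obtain ⟨v, w, hw, hlen⟩ := (SimpleGraph.is3Clique_iff_exists_cycle_length_three).1
      ⟨_, hclique⟩
    have := hcycle v w hw
    omega
  · rw [SimpleGraph.le_egirth]
    intro u w hw
    exact_mod_cast ((le_max_left g 3).trans_lt (hcycle u w hw)).le
  · rw [SimpleGraph.le_chromaticNumber_iff_colorable]
    intro m hm
    by_contra! hlt
    exact hcol ((hm.mono (by exact_mod_cast hlt.le)).of_hom iso.toHom)
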